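/- Let $t\in\{0,\dots,5\}$ and let $N>2$ be an even integer. Let $\sigma_0=\mathbb 1$ and let $\sigma_1,\sigma_2,\sigma_3$ be the Pauli matrices. Put $k_a=\mathrm i$ for $a\le t$ and $k_a=1$ for $t<a\le 5$, let $\eta_{ab}=\mathrm{diag}(k_1^2,\dots,k_5^2)$ (the metric of signature $(t,5-t)$), and consider the particular spinor representation $$\gamma_1=k_1\sigma_1\otimes\sigma_0,\quad \gamma_2=k_2\sigma_2\otimes\sigma_0,\quad \gamma_3=k_3\sigma_3\otimes\sigma_1,\quad \gamma_4=k_4\sigma_3\otimes\sigma_2,\quad \gamma_5=k_5\sigma_3\otimes\sigma_3,\quad C=\sigma_1\otimes\sigma_2 .$$ Let $(\gamma_a,C)$ be this representation or any spinor representation equivalent to it, i.e. one obtained by $\gamma_a\mapsto R^{-1}\gamma_aR$, $C\mapsto R^{\top}CR$ with an invertible complex $4\times4$ matrix $R$, and let $\gamma^a=\eta^{ab}\gamma_b$. Let $M=\mathrm{diag}(\sigma_2,\dots,\sigma_2)$ be the block-diagonal $N\times N$ matrix with $N/2$ blocks $\sigma_2$. Let $\Omega$ be the space of complex polynomials in anticommuting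 variables $c^1,\dots,c^5$ (translation ghosts) and commuting variables $\xi_i^{\alpha}$, $i=1,\dots,N$, $\alpha=1,\dots,4$ (supersymmetry ghosts), i.e. $\Omega=\Lambda(c^1,\dots,c^5)\otimes\mathbb C[\xi_i^\alpha]$. Let $$\mathrm{gh}=-\tfrac12\sum_{i,j,\alpha,\beta,a}M^{ij}\,(\gamma^aC^{-1})_{\alpha\beta}\,\xi_i^{\alpha}\xi_j^{\beta}\,\frac{\partial}{\partial c^a},\qquad N_c=\sum_a c^a\frac{\partial}{\partial c^a},$$ where $\partial/\partial c^a$ is the left derivative (an antiderivation), and write $\omega_1\sim\omega_2$ if $\omega_1-\omega_2=\mathrm{gh}\,\omega_3$ for some $\omega_3\in\Omega$. Then the cohomology of $\mathrm{gh}$ vanishes at every $c$-degree $p>1$: for every integer $p>1$ and every $\omega^p\in\Omega$ with $N_c\,\omega^p=p\,\omega^p$, $$\mathrm{gh}\,\omega^p=0\iff\omega^p\sim0 .$$ -/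

import Mathlib

open scoped Matrix Kronecker

namespace SusyAlg

noncomputable section

/-- The matrices `σ₀ = 1`, `σ₁`, `σ₂`, `σ₃` (identity and Pauli matrices). -/
def pauli : Fin 4 → Matrix (Fin 2) (Fin 2) ℂ :=
  ![1, !![0, 1; 1, 0], !![0, -Complex.I; Complex.I, 0], !![1, 0; 0, -1]]

/-- The tensor product `σ_r ⊗ σ_s` as a `4 × 4` matrix (standard Kronecker ordering:
the first factor labels the blocks). -/
def pauliTensor (r s : Fin 4) : Matrix (Fin 4) (Fin 4) ℂ :=
  Matrix.reindex finProdFinEquiv finProdFinEquiv (pauli r ⊗ₖ pauli s)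

/-- `k_a = i` for the first `t` directions and `k_a = 1` for the others
(directions are numbered from `0` here). -/
def kFactor (t : ℕ) (a : Fin 5) : ℂ := if (a : ℕ) < t then Complex.I else 1

/-- Diagonal entries of the flat metric of signature `(t, 5 - t)`, which is used to raise and
lower vector indices: `-1` for the first `t` directions, `+1` for the others. -/
def eta (t : ℕ) (a : Fin 5) : ℂ := if (a : ℕ) < t then -1 else 1

/-- The gamma matrices `γ_a` (lower index) of the particular spinor representation for signature
`(t, 5 - t)`. -/
def stdGamma (t : ℕ) (a : Fin 5) : Matrix (Fin 4) (Fin 4) ℂ :=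
  kFactor t a •
    (![pauliTensor 1 0, pauliTensor 2 0, pauliTensor 3 1, pauliTensor 3 2, pauliTensor 3 3] :
      Fin 5 → Matrix (Fin 4) (Fin 4) ℂ) a

/-- The charge conjugation matrix `C = σ₁ ⊗ σ₂` of the particular spinor representation. -/
def stdC : Matrix (Fin 4) (Fin 4) ℂ := pauliTensor 1 2

/-- The gamma matrices `γ_a` and the charge conjugation matrix `C` form a spinor representation
equivalent to the particular one: they arise from it by an invertible change of the spinor
basis. -/
def IsSpinorRep (t : ℕ) (γ : Fin 5 → Matrix (Fin 4) (Fin 4) ℂ)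
    (C : Matrix (Fin 4) (Fin 4) ℂ) : Prop :=
  ∃ R : Matrix (Fin 4) (Fin 4) ℂ, IsUnit R ∧
    (∀ a, γ a = R⁻¹ * stdGamma t a * R) ∧ C = Rᵀ * stdC * R

/-- The `N × N` block-diagonal matrix `M = diag(σ₂, …, σ₂)` (meant for even `N`). -/
def mMatrix (N : ℕ) : Matrix (Fin N) (Fin N) ℂ := fun i j =>
  if (i : ℕ) / 2 = (j : ℕ) / 2 then
    pauli 2 ⟨(i : ℕ) % 2, Nat.mod_lt _ two_pos⟩ ⟨(j : ℕ) % 2, Nat.mod_lt _ two_pos⟩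
  else 0

/-- Polynomials in the commuting supersymmetry ghosts; `MvPolynomial.X (i, α)` is `ξ_i^α`. -/
abbrev SusyPoly (N : ℕ) : Type := MvPolynomial (Fin N × Fin 4) ℂ

/-- The space of ghost polynomials: polynomials in the anticommuting translation ghosts
`c^1, …, c^5` and the commuting supersymmetry ghosts, that is, the exterior algebra on five
generators over the polynomials in the supersymmetry ghosts. -/
abbrev GhostPoly (N : ℕ) : Type := ExteriorAlgebra (SusyPoly N) (Fin 5 → SusyPoly N)

/-- The translation ghost `c^a`. -/
def cGhost (N : ℕ) (a : Fin 5) : GhostPoly N :=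
  ExteriorAlgebra.ι (SusyPoly N) (Pi.single a 1 : Fin 5 → SusyPoly N)

/-- The (left) derivative `∂/∂c^a`: the antiderivation, linear over the polynomials in the
supersymmetry ghosts, with `∂c^b/∂c^a = δ_a^b`. -/
def dC (N : ℕ) (a : Fin 5) : GhostPoly N →ₗ[SusyPoly N] GhostPoly N :=
  CliffordAlgebra.contractLeft (LinearMap.proj a : (Fin 5 → SusyPoly N) →ₗ[SusyPoly N] SusyPoly N)

/-- The counting operator `N_c = ∑_a c^a ∂/∂c^a` of the translation ghosts. -/
def cNumber (N : ℕ) (ω : GhostPoly N) : GhostPoly N :=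
  ∑ a, cGhost N a * dC N a ω

/-- The quadratic polynomial
`-1/2 ∑ M^{ij} (γ^a C⁻¹)_{αβ} ξ_i^α ξ_j^β`, where `γ^a = η^{aa} γ_a` has a raised index. -/
def ghC (N t : ℕ) (γ : Fin 5 → Matrix (Fin 4) (Fin 4) ℂ) (C : Matrix (Fin 4) (Fin 4) ℂ)
    (a : Fin 5) : SusyPoly N :=
  ∑ i, ∑ j, ∑ α, ∑ β,
    MvPolynomial.C (-(1 / 2) * mMatrix N i j * ((eta t a • γ a) * C⁻¹) α β) *
      MvPolynomial.X (i, α) * MvPolynomial.X (j, β)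

/-- The coboundary operator `gh = -1/2 M^{ij} (γ^a C⁻¹)_{αβ} ξ_i^α ξ_j^β ∂/∂c^a`. -/
def gh (N t : ℕ) (γ : Fin 5 → Matrix (Fin 4) (Fin 4) ℂ) (C : Matrix (Fin 4) (Fin 4) ℂ) :
    GhostPoly N →ₗ[SusyPoly N] GhostPoly N :=
  ∑ a, ghC N t γ C a • dC N a

/-- Equivalence in the cohomology of `gh`: the difference is a coboundary. -/
def GhEquiv (N t : ℕ) (γ : Fin 5 → Matrix (Fin 4) (Fin 4) ℂ) (C : Matrix (Fin 4) (Fin 4) ℂ)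
    (ω₁ ω₂ : GhostPoly N) : Prop :=
  ∃ ω₃ : GhostPoly N, ω₁ - ω₂ = gh N t γ C ω₃

end

end SusyAlg

namespace SusyAlg

/-! ### Exactness of Koszul complexes, one generator at a time. -/

section Koszul

open CliffordAlgebra Module

variable {R M κ : Type*} [CommRing R] [AddCommGroup M] [Module R M]

/-! `gh` is contraction of the exterior algebra with a linear form whose values on the generators
are five quadrics in the supersymmetry ghosts. The complex is therefore a Koszul complex, and `gh`
squares to zero. A change of spinor basis is an invertible substitution of the `ξ`, and the
signature only rescales the generators. After a constant linear change of the `c`, the quadrics are,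
up to that substitution and nonzero factors, P01, P23, P02, P13 and P03 + P12, where Pαβ is `pairing
N α β`.

For N ≥ 4 the first four form a regular sequence: for a suitable weight their top parts are
monomials in disjoint sets of variables. Hence their Koszul complex is exact away from scalars
(`KoszulExact.insert`). Regularity is obtained from `KoszulSyzygies`, the vanishing of first Koszul
homology, because that property passes from top parts to the polynomials themselves
(`KoszulSyzygies.of_leading`).

Nothing is needed about the fifth quadric: one more generator can create new homology only in
degrees zero and one. If ω is closed of degree p > 1, its contraction along the fifth coordinate is
closed without scalar part, hence exact over the first four generators, and
`KoszulExact.exists_of_contractLeft` lifts this to ω. -/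

theorem algebraMapInv_ι_mul (m : M) (x : ExteriorAlgebra R M) :
    ExteriorAlgebra.algebraMapInv (ExteriorAlgebra.ι R m * x) = 0 := by
  simp [ExteriorAlgebra.algebraMapInv]

theorem algebraMapInv_algebraMap (r : R) :
    ExteriorAlgebra.algebraMapInv (algebraMap R (ExteriorAlgebra R M) r) = r :=
  ExteriorAlgebra.algebraMap_leftInverse M r

theorem contractLeft_exteriorι_mul (d : Dual R M) (m : M) (x : ExteriorAlgebra R M) :
    contractLeft d (ExteriorAlgebra.ι R m * x) =
      d m • x - ExteriorAlgebra.ι R m * contractLeft d x :=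
  contractLeft_ι_mul d m x

theorem ι_mul_ι_mul_swap (m n : M) (x : ExteriorAlgebra R M) :
    ExteriorAlgebra.ι R m * (ExteriorAlgebra.ι R n * x) =
      -(ExteriorAlgebra.ι R n * (ExteriorAlgebra.ι R m * x)) := by
  have h := ExteriorAlgebra.ι_add_mul_swap (R := R) m n
  rw [← mul_assoc, ← mul_assoc, eq_neg_of_add_eq_zero_left h, neg_mul]

theorem contractLeft_eq_sum [Fintype κ] (b : Basis κ R M) (F : Dual R M)
    (x : ExteriorAlgebra R M) :
    contractLeft F x = ∑ a, F (b a) • contractLeft (b.coord a) x := by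
  have h : F = ∑ a, F (b a) • b.coord a := by
    refine b.ext fun j => ?_
    simp
  conv_lhs => rw [h, map_sum, LinearMap.sum_apply]
  simp only [map_smul, LinearMap.smul_apply]

/-- An element annihilated by the contractions with the coordinates in `T` is a scalar plus a
combination of multiples of the other generators. -/
theorem eq_algebraMap_add_sum [Fintype κ] [DecidableEq κ] (b : Basis κ R M) (T : Finset κ)
    (x : ExteriorAlgebra R M) (hx : ∀ a ∈ T, contractLeft (b.coord a) x = 0) :
    ∃ y : κ → ExteriorAlgebra R M, x = algebraMap R _ (ExteriorAlgebra.algebraMapInv x) +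
      ∑ a ∈ Tᶜ, ExteriorAlgebra.ι R (b a) * y a := by
  induction T using Finset.induction_on with
  | empty =>
    clear hx
    simp only [Finset.compl_empty]
    refine CliffordAlgebra.left_induction (0 : QuadraticForm R M) (P := fun x : ExteriorAlgebra R M =>
      ∃ y : κ → ExteriorAlgebra R M, x = algebraMap R _ (ExteriorAlgebra.algebraMapInv x) +
      ∑ a, ExteriorAlgebra.ι R (b a) * y a) ?_ ?_ ?_ x
    · intro r
      exact ⟨0, by simp⟩
    · rintro x y ⟨u, hu⟩ ⟨w, hw⟩
      refine ⟨u + w, ?_⟩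
      rw [map_add, map_add]
      conv_lhs => rw [hu, hw]
      simp only [Pi.add_apply, mul_add, Finset.sum_add_distrib]
      abel
    · intro x m _
      refine ⟨fun a => b.coord a m • x, ?_⟩
      have h0 : ExteriorAlgebra.algebraMapInv (ι (0 : QuadraticForm R M) m * x) = 0 :=
        algebraMapInv_ι_mul m x
      rw [h0, map_zero, zero_add]
      change ExteriorAlgebra.ι R m * x = _
      conv_lhs => rw [← b.sum_repr m, map_sum, Finset.sum_mul]
      simp only [map_smul, smul_mul_assoc, mul_smul_comm, Basis.coord_apply]
  | insert c T hc ih =>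
    obtain ⟨y, hy⟩ := ih fun a ha => hx a (Finset.mem_insert_of_mem ha)
    refine ⟨fun a => contractLeft (b.coord c) (ExteriorAlgebra.ι R (b c) * y a), ?_⟩
    -- Multiplying by `b c` and contracting again recovers `x`, while the `b c` term of the
    -- expansion disappears because `b c` squares to zero.
    have h1 : contractLeft (b.coord c) (ExteriorAlgebra.ι R (b c) * x) = x := by
      rw [contractLeft_exteriorι_mul, hx c (Finset.mem_insert_self c T)]
      simp
    conv_lhs => rw [← h1, hy]
    rw [mul_add, map_add]
    congr 1
    · rw [contractLeft_exteriorι_mul, contractLeft_algebraMap]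
      simp
    · rw [Finset.mul_sum, map_sum]
      have hT : Tᶜ = insert c (insert c T)ᶜ := by
        ext a
        simp only [Finset.mem_compl, Finset.mem_insert]
        by_cases h : a = c <;> simp [h, hc]
      rw [hT, Finset.sum_insert (by simp)]
      have hcc : ExteriorAlgebra.ι R (b c) * (ExteriorAlgebra.ι R (b c) * y c) = 0 := by
        rw [← mul_assoc, ExteriorAlgebra.ι_sq_zero, zero_mul]
      rw [hcc, map_zero, zero_add]
      refine Finset.sum_congr rfl fun a ha => ?_
      have hac : a ≠ c := by
        rintro rfl
        simp at ha
      rw [ι_mul_ι_mul_swap, map_neg, contractLeft_exteriorι_mul]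
      simp [hac]

/-- Exactness of the part of the Koszul complex of `F` spanned by the generators in `T`, at all
elements without scalar part. -/
def KoszulExact (b : Basis κ R M) (F : Dual R M) (T : Finset κ) : Prop :=
  ∀ x : ExteriorAlgebra R M, (∀ a ∉ T, contractLeft (b.coord a) x = 0) →
    contractLeft F x = 0 → ExteriorAlgebra.algebraMapInv x = 0 →
    ∃ y : ExteriorAlgebra R M, (∀ a ∉ T, contractLeft (b.coord a) y = 0) ∧ x = contractLeft F y

theorem koszulExact_empty [Fintype κ] [DecidableEq κ] (b : Basis κ R M) (F : Dual R M) :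
    KoszulExact b F ∅ := by
  intro x hx _ h0
  obtain ⟨y, hy⟩ := eq_algebraMap_add_sum b Finset.univ x fun a _ => hx a (Finset.notMem_empty a)
  refine ⟨0, by simp, ?_⟩
  rw [hy, h0]
  simp

/-- If the part of `x` along `b c` is exact, then so is `x`. -/
theorem KoszulExact.exists_of_contractLeft [DecidableEq κ] {b : Basis κ R M} {F : Dual R M}
    {T : Finset κ} (hT : KoszulExact b F T) {c : κ} (hc : c ∉ T) (x : ExteriorAlgebra R M)
    (hx : ∀ a ∉ insert c T, contractLeft (b.coord a) x = 0) (hFx : contractLeft F x = 0)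
    (h0 : ExteriorAlgebra.algebraMapInv x = 0) (z : ExteriorAlgebra R M)
    (hz : ∀ a ∉ T, contractLeft (b.coord a) z = 0)
    (hxz : contractLeft (b.coord c) x = contractLeft F z) :
    ∃ y : ExteriorAlgebra R M, (∀ a ∉ insert c T, contractLeft (b.coord a) y = 0) ∧
      x = contractLeft F y := by
  -- Contraction kills scalars, so the scalar part of `z` may be dropped.
  wlog hz0 : ExteriorAlgebra.algebraMapInv z = 0 generalizing z
  · refine this (z - algebraMap R _ (ExteriorAlgebra.algebraMapInv z)) ?_ ?_ ?_
    · intro a ha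
      rw [map_sub, hz a ha, contractLeft_algebraMap, sub_zero]
    · rw [map_sub, contractLeft_algebraMap, sub_zero, hxz]
    · rw [map_sub, algebraMapInv_algebraMap, sub_self]
  have hxw : x = x - ExteriorAlgebra.ι R (b c) * contractLeft F z
      + ExteriorAlgebra.ι R (b c) * contractLeft F z := by abel
  set w := x - ExteriorAlgebra.ι R (b c) * contractLeft F z with hw
  have hwT : ∀ a ∉ T, contractLeft (b.coord a) w = 0 := by
    intro a ha
    rw [hw, map_sub, contractLeft_exteriorι_mul, contractLeft_comm, hz a ha, map_zero, neg_zero,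
      mul_zero, sub_zero]
    by_cases hac : a = c
    · subst hac
      simp [hxz]
    · rw [hx a (by simp [hac, ha])]
      simp [Ne.symm hac]
  -- Write x = c·Fz + w with c = `b c`. Closedness of x gives Fw = -F(c)·Fz, so w + F(c)z is closed
  -- and equals Fy; then x = F(y - cz).
  obtain ⟨y, hyT, hy⟩ := hT (w + F (b c) • z) (fun a ha => by
      rw [map_add, map_smul, hwT a ha, hz a ha, smul_zero, add_zero])
    (by
      rw [map_add, map_smul, hw, map_sub, contractLeft_exteriorι_mul, hFx,
        contractLeft_contractLeft]
      simp)
    (by rw [map_add, map_smul, hz0, hw, map_sub, h0, algebraMapInv_ι_mul]; simp)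
  refine ⟨y - ExteriorAlgebra.ι R (b c) * z, ?_, ?_⟩
  · intro a ha
    have haT : a ∉ T := fun h => ha (Finset.mem_insert_of_mem h)
    have hac : c ≠ a := by
      rintro rfl
      exact ha (Finset.mem_insert_self _ _)
    rw [map_sub, contractLeft_exteriorι_mul, hyT a haT, hz a haT]
    simp [hac]
  · rw [map_sub, ← hy, contractLeft_exteriorι_mul, hxw]
    abel

/-- The contraction u of x along the new generator is closed, but may have a scalar part u₀. The
degree-zero part of Fx = 0 says that F(c)·u₀ lies in the ideal of the old values; regularity puts u₀
itself there, so u₀ is a boundary and u is exact. -/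
theorem KoszulExact.insert [Fintype κ] [DecidableEq κ] {b : Basis κ R M} {F : Dual R M}
    {T : Finset κ} (hT : KoszulExact b F T) {c : κ} (hc : c ∉ T)
    (hreg : ∀ (r : R) (g : κ → R), F (b c) * r = ∑ a ∈ T, g a * F (b a) →
      ∃ g' : κ → R, r = ∑ a ∈ T, g' a * F (b a)) :
    KoszulExact b F (insert c T) := by
  intro x hx hFx h0
  set u := contractLeft (b.coord c) x with hu
  set w := x - ExteriorAlgebra.ι R (b c) * u with hw
  have huT : ∀ a ∉ T, contractLeft (b.coord a) u = 0 := by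
    intro a ha
    by_cases hac : a = c
    · rw [hu, hac, contractLeft_contractLeft]
    · rw [hu, contractLeft_comm, hx a (by simp [hac, ha]), map_zero, neg_zero]
  have hFu : contractLeft F u = 0 := by
    rw [hu, contractLeft_comm, hFx, map_zero, neg_zero]
  have hwT : ∀ a ∉ T, contractLeft (b.coord a) w = 0 := by
    intro a ha
    rw [hw, map_sub, contractLeft_exteriorι_mul, huT a ha, mul_zero, sub_zero]
    by_cases hac : a = c
    · subst hac
      simp [hu]
    · rw [hx a (by simp [hac, ha])]
      simp [Ne.symm hac]
  have hFw : contractLeft F w = -(F (b c) • u) := by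
    rw [hw, map_sub, hFx, contractLeft_exteriorι_mul, hFu]
    simp
  have hFw' : ExteriorAlgebra.algebraMapInv (contractLeft F w) = ∑ a ∈ T,
      ExteriorAlgebra.algebraMapInv (contractLeft (b.coord a) w) * F (b a) := by
    rw [contractLeft_eq_sum b F w, map_sum]
    rw [← Finset.sum_subset (Finset.subset_univ T) (fun a _ ha => by rw [hwT a ha]; simp)]
    refine Finset.sum_congr rfl fun a _ => ?_
    rw [map_smul, smul_eq_mul, mul_comm]
  obtain ⟨g, hg⟩ := hreg (ExteriorAlgebra.algebraMapInv u)
    (fun a => -ExteriorAlgebra.algebraMapInv (contractLeft (b.coord a) w)) (by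
      rw [hFw, map_neg, map_smul, smul_eq_mul] at hFw'
      simp only [neg_mul, Finset.sum_neg_distrib]
      rw [← hFw', neg_neg])
  -- This degree-one element has boundary equal to the scalar part of `u`.
  set s := ExteriorAlgebra.ι R (∑ a ∈ T, g a • b a) with hs
  have hFs : contractLeft F s = algebraMap R _ (ExteriorAlgebra.algebraMapInv u) := by
    rw [hs, hg]
    refine (contractLeft_ι (0 : QuadraticForm R M) _ _).trans ?_
    simp
  have hsT : ∀ a ∉ T, contractLeft (b.coord a) s = 0 := by
    intro a ha
    rw [hs]
    refine (contractLeft_ι (0 : QuadraticForm R M) _ _).trans ?_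
    rw [map_sum, Finset.sum_eq_zero, map_zero]
    intro j hj
    have hja : j ≠ a := by
      rintro rfl
      exact ha hj
    simp [hja]
  obtain ⟨z, hzT, hz⟩ := hT (u - contractLeft F s)
    (fun a ha => by
      rw [map_sub, huT a ha, contractLeft_comm, hsT a ha, map_zero, neg_zero, sub_zero])
    (by rw [map_sub, hFu, contractLeft_contractLeft, sub_zero])
    (by rw [map_sub, hFs, algebraMapInv_algebraMap, sub_self])
  refine hT.exists_of_contractLeft hc x hx hFx h0 (z + s) (fun a ha => by
    rw [map_add, hzT a ha, hsT a ha, add_zero]) ?_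
  rw [map_add, ← hz]
  abel

end Koszul

end SusyAlg

namespace SusyAlg

/-! ### Regularity through trivial syzygies, and passage from top parts. -/

section Syzygies

variable {R κ : Type*} [CommRing R]

/-- Every syzygy of the family `f` on `S` is a combination of the trivial ones. -/
def KoszulSyzygies (f : κ → R) (S : Finset κ) : Prop :=
  ∀ a : κ → R, ∑ i ∈ S, f i * a i = 0 →
    ∃ s : κ → κ → R, ∀ i ∈ S, a i = ∑ j ∈ S, (s i j - s j i) * f j

theorem KoszulSyzygies.congr {f f' : κ → R} {S : Finset κ} (h : KoszulSyzygies f S)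
    (hf : ∀ i ∈ S, f i = f' i) : KoszulSyzygies f' S := by
  intro a ha
  obtain ⟨s, hs⟩ := h a (by rw [← ha]; exact Finset.sum_congr rfl fun i hi => by rw [hf i hi])
  exact ⟨s, fun i hi => (hs i hi).trans (Finset.sum_congr rfl fun j hj => by rw [hf j hj])⟩

theorem sum_trivial_syzygy (f : κ → R) (S : Finset κ) (s : κ → κ → R) :
    ∑ i ∈ S, f i * ∑ j ∈ S, (s i j - s j i) * f j = 0 := by
  simp only [Finset.mul_sum, sub_mul, mul_sub, Finset.sum_sub_distrib]
  rw [sub_eq_zero, Finset.sum_comm]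
  exact Finset.sum_congr rfl fun i _ => Finset.sum_congr rfl fun j _ => by ring

theorem KoszulSyzygies.regular [DecidableEq κ] {f : κ → R} {T : Finset κ} {c : κ} (hc : c ∉ T)
    (h : KoszulSyzygies f (insert c T)) (r : R) (g : κ → R)
    (hr : f c * r = ∑ a ∈ T, g a * f a) : ∃ g' : κ → R, r = ∑ a ∈ T, g' a * f a := by
  -- The relation is the syzygy (r, -g); its triviality, read at index `c`, puts `r` in the ideal.
  obtain ⟨s, hs⟩ := h (fun i => if i = c then r else -g i) (by
    rw [Finset.sum_insert hc]
    simp only [if_true]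
    rw [hr, ← Finset.sum_add_distrib]
    refine Finset.sum_eq_zero fun i hi => ?_
    rw [if_neg (by rintro rfl; exact hc hi)]
    ring)
  refine ⟨fun j => s c j - s j c, ?_⟩
  have := hs c (Finset.mem_insert_self c T)
  rw [Finset.sum_insert hc] at this
  simpa using this

theorem koszulSyzygies_insert [DecidableEq κ] {f : κ → R} {T : Finset κ} {c : κ} (hc : c ∉ T)
    (hT : KoszulSyzygies f T) (hreg : ∀ (r : R) (g : κ → R), f c * r = ∑ a ∈ T, g a * f a →
      ∃ g' : κ → R, r = ∑ a ∈ T, g' a * f a) :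
    KoszulSyzygies f (insert c T) := by
  intro a ha
  rw [Finset.sum_insert hc] at ha
  obtain ⟨g, hg⟩ := hreg (a c) (fun i => -a i) (by
    rw [eq_neg_of_add_eq_zero_left ha, ← Finset.sum_neg_distrib]
    exact Finset.sum_congr rfl fun i _ => by ring)
  obtain ⟨s, hs⟩ := hT (fun i => a i + g i * f c) (by
    rw [← ha, hg, Finset.mul_sum, ← Finset.sum_add_distrib]
    exact Finset.sum_congr rfl fun i _ => by ring)
  have hne : ∀ i ∈ T, i ≠ c := by
    rintro i hi rfl
    exact hc hi
  -- Row `c` holds the coefficients `g` expressing `a c`, and column `c` is zero; the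
  -- antisymmetrisation then contributes -g i · f c to each old entry, as required.
  refine ⟨fun i j => if j = c then 0 else if i = c then g j else s i j, fun i hi => ?_⟩
  rw [Finset.sum_insert hc]
  by_cases hic : i = c
  · subst hic
    simp only [if_true, sub_self, zero_mul, zero_add]
    rw [hg]
    refine Finset.sum_congr rfl fun j hj => ?_
    rw [if_neg (hne j hj), sub_zero]
  · have hiT : i ∈ T := (Finset.mem_insert.mp hi).resolve_left hic
    simp only [if_true, if_neg hic, zero_sub]
    rw [← sub_eq_iff_eq_add']
    calc a i - -g i * f c = a i + g i * f c := by ring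
      _ = _ := hs i hiT
      _ = _ := Finset.sum_congr rfl fun j hj => by
        rw [if_neg (hne j hj), if_neg (hne j hj)]

open Polynomial in
/-- If `Φ` is a grading of `R` (as a coaction) and the top parts of the `f i`, all of the same
degree, have only trivial syzygies, then so have the `f i`. -/
theorem KoszulSyzygies.of_leading (Φ : R →+* R[X]) (hΦ1 : ∀ r, (Φ r).eval 1 = r)
    (hΦ2 : ∀ r m, Φ ((Φ r).coeff m) = C ((Φ r).coeff m) * X ^ m) {f : κ → R} {S : Finset κ}
    (d : ℕ) (hf : ∀ i ∈ S, (Φ (f i)).natDegree ≤ d)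
    (hL : KoszulSyzygies (fun i => (Φ (f i)).coeff d) S) : KoszulSyzygies f S := by
  -- Induction on a strict bound for the degrees of the `a i`: their degree-n parts form a syzygy of
  -- the top parts, so subtracting a trivial syzygy of `f` lowers the bound.
  suffices H : ∀ n : ℕ, ∀ a : κ → R, (∀ i ∈ S, ∀ m, n ≤ m → (Φ (a i)).coeff m = 0) →
      ∑ i ∈ S, f i * a i = 0 →
      ∃ s : κ → κ → R, ∀ i ∈ S, a i = ∑ j ∈ S, (s i j - s j i) * f j by
    intro a ha
    refine H (S.sup (fun i => (Φ (a i)).natDegree) + 1) a (fun i hi m hm => ?_) ha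
    refine coeff_eq_zero_of_natDegree_lt (lt_of_lt_of_le (Nat.lt_succ_of_le ?_) hm)
    exact Finset.le_sup (f := fun i => (Φ (a i)).natDegree) hi
  intro n
  induction n with
  | zero =>
    intro a ha _
    refine ⟨0, fun i hi => ?_⟩
    have : Φ (a i) = 0 := Polynomial.ext fun m => by simpa using ha i hi m (Nat.zero_le m)
    rw [← hΦ1 (a i), this]
    simp
  | succ n ih =>
    intro a ha h0
    obtain ⟨s, hs⟩ := hL (fun i => (Φ (a i)).coeff n) (by
      have := congrArg (fun r => (Φ r).coeff (d + n)) h0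
      simp only [map_sum, map_mul, finsetSum_coeff, map_zero, coeff_zero] at this
      rw [← this]
      refine Finset.sum_congr rfl fun i hi => (coeff_mul_add_eq_of_natDegree_le (hf i hi) ?_).symm
      exact natDegree_le_iff_coeff_eq_zero.mpr fun m hm => ha i hi m hm)
    -- Only the component of degree n - d matters. Keeping just that one ensures that the subtracted
    -- syzygy has no part above degree n; it is zero when n < d.
    set s' : κ → κ → R := fun i j => if d ≤ n then (Φ (s i j)).coeff (n - d) else 0 with hs'
    have hΦs : ∀ i j k m, (Φ (s' i j * f k)).coeff m =
        if n ≤ m + d then s' i j * (Φ (f k)).coeff (m + d - n) else 0 := by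
      intro i j k m
      simp only [hs']
      split_ifs with hdn h1
      · rw [map_mul, hΦ2, mul_assoc, coeff_C_mul, coeff_X_pow_mul', if_pos (by omega)]
        congr 2
        omega
      · rw [map_mul, hΦ2, mul_assoc, coeff_C_mul, coeff_X_pow_mul', if_neg (by omega), mul_zero]
      · simp
      · simp
    have htop : ∀ i ∈ S, (Φ (a i)).coeff n = ∑ j ∈ S, (s' i j - s' j i) * (Φ (f j)).coeff d := by
      intro i hi
      have h1 := congrArg (fun r => (Φ r).coeff n) (hs i hi)
      simp only [hΦ2, map_sum, map_mul, map_sub, finsetSum_coeff] at h1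
      rw [coeff_C_mul, coeff_X_pow_self, mul_one] at h1
      rw [h1]
      refine Finset.sum_congr rfl fun j _ => ?_
      rw [← mul_assoc, coeff_mul_X_pow', coeff_mul_C, coeff_sub]
      simp only [hs']
      split_ifs <;> simp
    obtain ⟨s'', hs''⟩ := ih (fun i => a i - ∑ j ∈ S, (s' i j - s' j i) * f j) (by
      intro i hi m hm
      rw [map_sub, coeff_sub, map_sum, finsetSum_coeff]
      simp only [sub_mul, map_sub, coeff_sub, hΦs]
      rcases hm.eq_or_lt with rfl | hm
      · rw [htop i hi, sub_eq_zero]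
        refine Finset.sum_congr rfl fun j _ => ?_
        simp [sub_mul]
      · rw [ha i hi m hm, zero_sub, neg_eq_zero]
        refine Finset.sum_eq_zero fun j hj => ?_
        rw [coeff_eq_zero_of_natDegree_lt (lt_of_le_of_lt (hf j hj) (by omega))]
        simp) (by
      simp only [mul_sub, Finset.sum_sub_distrib]
      rw [h0, sum_trivial_syzygy, sub_zero])
    refine ⟨s' + s'', fun i hi => ?_⟩
    rw [← sub_add_cancel (a i) (∑ j ∈ S, (s' i j - s' j i) * f j), hs'' i hi,
      ← Finset.sum_add_distrib]
    exact Finset.sum_congr rfl fun j _ => by simp only [Pi.add_apply]; ring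

end Syzygies

/-! ### Coprime monomials and weight gradings. -/

section MvPolynomial

open MvPolynomial

variable {A σ κ : Type*} [CommRing A]

/-- Membership in a monomial ideal is tested on exponents. If `m j` divides `m c + e` and is coprime
to `m c`, it divides `e`; so each new monomial is regular modulo the previous ones. -/
theorem koszulSyzygies_monomial [DecidableEq κ] (m : κ → σ →₀ ℕ)
    (hm : Pairwise fun i j => Disjoint (m i).support (m j).support) (S : Finset κ) :
    KoszulSyzygies (fun i => monomial (m i) (1 : A)) S := by
  induction S using Finset.induction_on with
  | empty => exact fun a _ => ⟨0, by simp⟩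
  | insert c T hc ih =>
    refine koszulSyzygies_insert hc ih fun r g hr => ?_
    have hspan : ∀ x : MvPolynomial σ A, (∃ g : κ → MvPolynomial σ A,
        x = ∑ a ∈ T, g a * monomial (m a) 1) ↔
        ∀ e ∈ x.support, ∃ j ∈ T, m j ≤ e := by
      intro x
      have h1 := mem_ideal_span_monomial_image (x := x) (s := m '' (T : Set κ))
      rw [Set.image_image, Ideal.span, Submodule.mem_span_image_finset_iff_exists_fun'] at h1
      simp only [smul_eq_mul, Set.exists_mem_image, Finset.mem_coe] at h1
      rw [← h1]
      exact exists_congr fun g => eq_comm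
    rw [hspan]
    intro e he
    obtain ⟨j, hj, hje⟩ := (hspan _).mp ⟨g, hr⟩ (m c + e) (by
      rw [mem_support_iff, coeff_monomial_mul, one_mul]
      exact mem_support_iff.mp he)
    refine ⟨j, hj, fun k => ?_⟩
    by_cases hk : m j k = 0
    · rw [hk]
      exact Nat.zero_le _
    · have hck : m c k = 0 := by
        have hcj : j ≠ c := by
          rintro rfl
          exact hc hj
        exact Finsupp.notMem_support_iff.mp
          (Finset.disjoint_left.mp (hm hcj) (Finsupp.mem_support_iff.mpr hk))
      have := hje k
      rwa [Finsupp.add_apply, hck, zero_add] at this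

/-- The grading of the polynomial ring by the weights `w`, as a coaction. -/
noncomputable def weightCoaction (w : σ → ℕ) :
    MvPolynomial σ A →+* Polynomial (MvPolynomial σ A) :=
  eval₂Hom (Polynomial.C.comp C) fun s => Polynomial.C (X s) * Polynomial.X ^ w s

theorem weightCoaction_C (w : σ → ℕ) (a : A) :
    weightCoaction w (C a : MvPolynomial σ A) = Polynomial.C (C a) := by
  simp [weightCoaction]

theorem weightCoaction_X (w : σ → ℕ) (s : σ) :
    weightCoaction w (X s : MvPolynomial σ A) = Polynomial.C (X s) * Polynomial.X ^ w s := by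
  simp [weightCoaction]

theorem eval_one_weightCoaction (w : σ → ℕ) (p : MvPolynomial σ A) :
    (weightCoaction w p).eval 1 = p := by
  have : (Polynomial.evalRingHom 1).comp (weightCoaction w) =
      RingHom.id (MvPolynomial σ A) := by
    ext s <;> simp [weightCoaction_C, weightCoaction_X]
  exact RingHom.congr_fun this p

theorem weightCoaction_coeff (w : σ → ℕ) (p : MvPolynomial σ A) (n : ℕ) :
    weightCoaction w ((weightCoaction w p).coeff n) =
      Polynomial.C ((weightCoaction w p).coeff n) * Polynomial.X ^ n := by
  induction p using MvPolynomial.induction_on generalizing n with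
  | C a =>
    rw [weightCoaction_C, Polynomial.coeff_C]
    split_ifs with h
    · rw [weightCoaction_C, h, pow_zero, mul_one]
    · simp
  | add p q hp hq => simp only [map_add, Polynomial.coeff_add, hp, hq, add_mul]
  | mul_X p s hp =>
    rw [map_mul, weightCoaction_X, ← mul_assoc, Polynomial.coeff_mul_X_pow']
    split_ifs with h
    · rw [Polynomial.coeff_mul_C, map_mul, hp, weightCoaction_X, map_mul]
      conv_rhs => rw [← Nat.sub_add_cancel h, pow_add, Nat.sub_add_cancel h]
      ring
    · simp

end MvPolynomial

end SusyAlg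

/-! ### Reduction of the quadrics to antisymmetric pairings. -/

namespace SusyAlg

open MvPolynomial

/-- The antisymmetric bilinear combination `M^{ij} ξ_i^α ξ_j^β` of the supersymmetry ghosts. -/
noncomputable def pairing (N : ℕ) (α β : Fin 4) : SusyPoly N :=
  ∑ i, ∑ j, C (mMatrix N i j) * X (i, α) * X (j, β)

theorem pauli_two_antisymm (i j : Fin 2) : pauli 2 i j = -pauli 2 j i := by
  fin_cases i <;> fin_cases j <;> simp [pauli]

theorem mMatrix_antisymm (N : ℕ) (i j : Fin N) : mMatrix N i j = -mMatrix N j i := by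
  unfold mMatrix
  by_cases h : (i : ℕ) / 2 = j / 2
  · rw [if_pos h, if_pos h.symm]
    exact pauli_two_antisymm _ _
  · rw [if_neg h, if_neg (Ne.symm h), neg_zero]

theorem pairing_antisymm (N : ℕ) (α β : Fin 4) : pairing N β α = -pairing N α β := by
  unfold pairing
  rw [Finset.sum_comm, ← Finset.sum_neg_distrib]
  refine Finset.sum_congr rfl fun i _ => ?_
  rw [← Finset.sum_neg_distrib]
  refine Finset.sum_congr rfl fun j _ => ?_
  rw [mMatrix_antisymm N j i, C_neg]
  ring

theorem ghC_eq_sum_pairing (N t : ℕ) (γ : Fin 5 → Matrix (Fin 4) (Fin 4) ℂ)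
    (D : Matrix (Fin 4) (Fin 4) ℂ) (a : Fin 5) :
    ghC N t γ D a =
      ∑ α, ∑ β, C (-(1 / 2) * ((eta t a • γ a) * D⁻¹) α β) * pairing N α β := by
  unfold ghC pairing
  simp only [Finset.mul_sum]
  have h1 : ∀ (α : Fin 4), ∑ β : Fin 4, ∑ i : Fin N, ∑ j : Fin N,
      (C (-(1 / 2) * ((eta t a • γ a) * D⁻¹) α β) *
        (C (mMatrix N i j) * X (i, α) * X (j, β)) : SusyPoly N) =
      ∑ i : Fin N, ∑ j : Fin N, ∑ β : Fin 4,
      (C (-(1 / 2) * ((eta t a • γ a) * D⁻¹) α β) *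
        (C (mMatrix N i j) * X (i, α) * X (j, β)) : SusyPoly N) := by
    intro α
    rw [Finset.sum_comm]
    exact Finset.sum_congr rfl fun i _ => Finset.sum_comm
  simp only [h1]
  rw [Finset.sum_comm (s := (Finset.univ : Finset (Fin 4)))]
  refine Finset.sum_congr rfl fun i _ => Eq.trans ?_ Finset.sum_comm
  refine Finset.sum_congr rfl fun j _ => Finset.sum_congr rfl fun α _ =>
    Finset.sum_congr rfl fun β _ => ?_
  simp only [C_mul]
  ring

/-! ### Independence of the spinor basis. -/

section ChangeOfSpinorBasis

/-- The linear substitution of the supersymmetry ghosts given by a matrix on spinor indices. -/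
noncomputable def spinorSubst (N : ℕ) (A : Matrix (Fin 4) (Fin 4) ℂ) :
    SusyPoly N →ₐ[ℂ] SusyPoly N :=
  aeval fun s => ∑ β, C (A s.2 β) * X (s.1, β)

theorem spinorSubst_X (N : ℕ) (A : Matrix (Fin 4) (Fin 4) ℂ) (i : Fin N) (α : Fin 4) :
    spinorSubst N A (X (i, α)) = ∑ β, C (A α β) * X (i, β) := by
  simp [spinorSubst]

theorem spinorSubst_C (N : ℕ) (A : Matrix (Fin 4) (Fin 4) ℂ) (z : ℂ) :
    spinorSubst N A (C z) = C z :=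
  (spinorSubst N A).commutes z

theorem spinorSubst_comp_of_mul_eq_one (N : ℕ) {A B : Matrix (Fin 4) (Fin 4) ℂ} (h : B * A = 1) :
    (spinorSubst N A).comp (spinorSubst N B) = AlgHom.id ℂ (SusyPoly N) := by
  ext1 ⟨i, α⟩
  rw [AlgHom.comp_apply, spinorSubst_X, map_sum, AlgHom.id_apply]
  simp only [map_mul, spinorSubst_C, spinorSubst_X, Finset.mul_sum]
  rw [Finset.sum_comm]
  have h2 : ∀ β, ∑ δ, (C (B α δ) * (C (A δ β) * X (i, β)) : SusyPoly N) =
      C ((1 : Matrix (Fin 4) (Fin 4) ℂ) α β) * X (i, β) := by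
    intro β
    rw [← h, Matrix.mul_apply, map_sum, Finset.sum_mul]
    exact Finset.sum_congr rfl fun δ _ => by rw [C_mul, mul_assoc]
  simp only [h2]
  rw [Finset.sum_eq_single α]
  · simp
  · intro β _ hβ
    rw [Matrix.one_apply_ne (Ne.symm hβ)]
    simp
  · simp

theorem spinorSubst_pairing (N : ℕ) (A : Matrix (Fin 4) (Fin 4) ℂ) (α β : Fin 4) :
    spinorSubst N A (pairing N α β) =
      ∑ ρ, ∑ τ, C (A α ρ * A β τ) * pairing N ρ τ := by
  unfold pairing
  simp only [map_sum, map_mul, spinorSubst_C, spinorSubst_X, Finset.mul_sum, Finset.sum_mul]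
  have h1 : ∀ (f : Fin 4 → Fin 4 → Fin N → Fin N → SusyPoly N),
      ∑ ρ, ∑ τ, ∑ i, ∑ j, f ρ τ i j = ∑ i, ∑ j, ∑ τ, ∑ ρ, f ρ τ i j := by
    intro f
    rw [Finset.sum_comm]
    calc _ = ∑ τ, ∑ i, ∑ ρ, ∑ j, f ρ τ i j := Finset.sum_congr rfl fun _ _ => Finset.sum_comm
      _ = ∑ i, ∑ τ, ∑ ρ, ∑ j, f ρ τ i j := Finset.sum_comm
      _ = ∑ i, ∑ τ, ∑ j, ∑ ρ, f ρ τ i j := Finset.sum_congr rfl fun _ _ =>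
        Finset.sum_congr rfl fun _ _ => Finset.sum_comm
      _ = _ := Finset.sum_congr rfl fun _ _ => Finset.sum_comm
  rw [h1]
  refine Finset.sum_congr rfl fun i _ => Finset.sum_congr rfl fun j _ =>
    Finset.sum_congr rfl fun τ _ => Finset.sum_congr rfl fun ρ _ => ?_
  ring

/-- The matrix G = γC⁻¹ becomes R⁻¹ G R⁻ᵀ, a congruence, which a linear substitution of the `ξ`
absorbs. -/
theorem ghC_of_change (N t : ℕ) (R : Matrix (Fin 4) (Fin 4) ℂ) (hR : IsUnit R) (a : Fin 5) :
    ghC N t (fun a => R⁻¹ * stdGamma t a * R) (Rᵀ * stdC * R) a =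
      spinorSubst N (R⁻¹)ᵀ (ghC N t (stdGamma t) stdC a) := by
  have hdet : IsUnit R.det := (Matrix.isUnit_iff_isUnit_det R).mp hR
  have hG : (eta t a • (R⁻¹ * stdGamma t a * R)) * (Rᵀ * stdC * R)⁻¹ =
      R⁻¹ * ((eta t a • stdGamma t a) * stdC⁻¹) * (R⁻¹)ᵀ := by
    rw [Matrix.mul_inv_rev, Matrix.mul_inv_rev, Matrix.transpose_nonsing_inv]
    simp only [Matrix.smul_mul, Matrix.mul_smul, Matrix.mul_assoc]
    rw [Matrix.mul_nonsing_inv_cancel_left R _ hdet]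
  rw [ghC_eq_sum_pairing, ghC_eq_sum_pairing, hG]
  simp only [map_sum, map_mul, spinorSubst_C, spinorSubst_pairing]
  generalize (eta t a • stdGamma t a) * stdC⁻¹ = G
  generalize R⁻¹ = S
  simp only [Finset.mul_sum, Matrix.mul_apply, map_sum, Finset.sum_mul, Matrix.transpose_apply]
  have h1 : ∀ (f : Fin 4 → Fin 4 → Fin 4 → Fin 4 → SusyPoly N),
      ∑ ρ, ∑ τ, ∑ i, ∑ j, f ρ τ i j = ∑ j, ∑ i, ∑ ρ, ∑ τ, f ρ τ i j := by
    intro f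
    calc _ = ∑ ρ, ∑ τ, ∑ j, ∑ i, f ρ τ i j := Finset.sum_congr rfl fun _ _ =>
          Finset.sum_congr rfl fun _ _ => Finset.sum_comm
      _ = ∑ ρ, ∑ j, ∑ τ, ∑ i, f ρ τ i j := Finset.sum_congr rfl fun _ _ => Finset.sum_comm
      _ = ∑ j, ∑ ρ, ∑ τ, ∑ i, f ρ τ i j := Finset.sum_comm
      _ = ∑ j, ∑ ρ, ∑ i, ∑ τ, f ρ τ i j := Finset.sum_congr rfl fun _ _ =>
        Finset.sum_congr rfl fun _ _ => Finset.sum_comm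
      _ = _ := Finset.sum_congr rfl fun _ _ => Finset.sum_comm
  rw [h1]
  refine Finset.sum_congr rfl fun i _ => Finset.sum_congr rfl fun j _ =>
    Finset.sum_congr rfl fun τ _ => Finset.sum_congr rfl fun ρ _ => ?_
  simp only [C_mul]
  ring

end ChangeOfSpinorBasis

/-! ### The five quadrics in the particular representation. -/

section StandardRepresentation

theorem stdC_inv : stdC⁻¹ = stdC := by
  refine Matrix.inv_eq_right_inv ?_
  unfold stdC pauliTensor
  simp only [Matrix.reindex_apply, Matrix.submatrix_mul_equiv, ← Matrix.mul_kronecker_mul]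
  have h1 : pauli 1 * pauli 1 = 1 := by
    ext i j; fin_cases i <;> fin_cases j <;> simp [pauli]
  have h2 : pauli 2 * pauli 2 = 1 := by
    ext i j; fin_cases i <;> fin_cases j <;> simp [pauli]
  rw [h1, h2, Matrix.one_kronecker_one, Matrix.submatrix_one_equiv]

theorem pauliTensor_mul_stdC (r s : Fin 4) : pauliTensor r s * stdC =
    Matrix.reindex finProdFinEquiv finProdFinEquiv
      ((pauli r * pauli 1) ⊗ₖ (pauli s * pauli 2)) := by
  unfold stdC pauliTensor
  simp only [Matrix.reindex_apply, Matrix.submatrix_mul_equiv, ← Matrix.mul_kronecker_mul]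

/-- The nonzero factors `η^{aa} k_a`. -/
noncomputable def raisedFactor (t : ℕ) (a : Fin 5) : ℂ := eta t a * kFactor t a

theorem raisedFactor_ne_zero (t : ℕ) (a : Fin 5) : raisedFactor t a ≠ 0 := by
  unfold raisedFactor eta kFactor
  split_ifs <;> simp

/-- The five quadratic polynomials of the standard representation, up to factors. -/
noncomputable def stdQuadric (N : ℕ) : Fin 5 → SusyPoly N :=
  ![C Complex.I * (pairing N 0 1 + pairing N 2 3),
    pairing N 0 1 - pairing N 2 3,
    C Complex.I * (pairing N 1 3 - pairing N 0 2),
    -(pairing N 0 2 + pairing N 1 3),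
    C Complex.I * (pairing N 0 3 + pairing N 1 2)]

theorem stdGamma_mul_stdC_inv (t : ℕ) (a : Fin 5) :
    (eta t a • stdGamma t a) * stdC⁻¹ = raisedFactor t a •
      (![!![0, -Complex.I, 0, 0; Complex.I, 0, 0, 0; 0, 0, 0, -Complex.I; 0, 0, Complex.I, 0],
        !![0, -1, 0, 0; 1, 0, 0, 0; 0, 0, 0, 1; 0, 0, -1, 0],
        !![0, 0, Complex.I, 0; 0, 0, 0, -Complex.I; -Complex.I, 0, 0, 0; 0, Complex.I, 0, 0],
        !![0, 0, 1, 0; 0, 0, 0, 1; -1, 0, 0, 0; 0, -1, 0, 0],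
        !![0, 0, 0, -Complex.I; 0, 0, -Complex.I, 0; 0, Complex.I, 0, 0; Complex.I, 0, 0, 0]] :
      Fin 5 → Matrix (Fin 4) (Fin 4) ℂ) a := by
  unfold stdGamma
  rw [stdC_inv, smul_smul, Matrix.smul_mul, raisedFactor]
  congr 1
  fin_cases a <;>
    simp only [Fin.zero_eta, Fin.mk_one, Fin.reduceFinMk, Matrix.cons_val,
      Matrix.cons_val_zero, Matrix.cons_val_one, pauliTensor_mul_stdC] <;>
    ext i j <;> fin_cases i <;> fin_cases j <;>
    simp [finProdFinEquiv, Fin.divNat, Fin.modNat, pauli]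

theorem ghC_std (N t : ℕ) (a : Fin 5) :
    ghC N t (stdGamma t) stdC a = C (raisedFactor t a) * stdQuadric N a := by
  rw [ghC_eq_sum_pairing, stdGamma_mul_stdC_inv]
  have h2 : (C 2⁻¹ * 2 : SusyPoly N) = 1 := by
    rw [← map_ofNat C 2, ← C_mul]; norm_num
  generalize raisedFactor t a = κ
  fin_cases a <;>
    simp [Fin.sum_univ_four, stdQuadric, pairing_antisymm N 0 1, pairing_antisymm N 0 2,
      pairing_antisymm N 0 3, pairing_antisymm N 1 2, pairing_antisymm N 1 3,
      pairing_antisymm N 2 3]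
  · linear_combination C κ * (C Complex.I * (pairing N 0 1 + pairing N 2 3)) * h2
  · linear_combination C κ * (pairing N 0 1 - pairing N 2 3) * h2
  · linear_combination C κ * (C Complex.I * (pairing N 1 3 - pairing N 0 2)) * h2
  · linear_combination C κ * (-pairing N 1 3 + -pairing N 0 2) * h2
  · linear_combination C κ * (C Complex.I * (pairing N 0 3 + pairing N 1 2)) * h2

end StandardRepresentation

end SusyAlg

namespace SusyAlg

open MvPolynomial

/-! ### Regularity of four of the quadrics. -/

section Regularity

/-- The weight that is one on the eight variables in the leading monomials and zero elsewhere. -/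
def leadWeight (N : ℕ) (s : Fin N × Fin 4) : ℕ :=
  if (s.2 = 0 ∧ (s.1 : ℕ) / 2 = 0) ∨ (s.2 = 1 ∧ (s.1 : ℕ) / 2 ≤ 1 ∧ (s.1 : ℕ) % 2 = 1) ∨
    (s.2 = 2 ∧ (s.1 : ℕ) / 2 ≤ 1 ∧ (s.1 : ℕ) % 2 = 0) ∨ (s.2 = 3 ∧ (s.1 : ℕ) / 2 = 1)
  then 1 else 0

theorem leadWeight_le_one (N : ℕ) (s : Fin N × Fin 4) : leadWeight N s ≤ 1 := by
  unfold leadWeight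
  split_ifs <;> simp

theorem weightCoaction_pairing (N : ℕ) (w : Fin N × Fin 4 → ℕ) (α β : Fin 4) :
    weightCoaction w (pairing N α β) = ∑ i, ∑ j,
      Polynomial.C (C (mMatrix N i j) * X (i, α) * X (j, β)) *
        Polynomial.X ^ (w (i, α) + w (j, β)) := by
  unfold pairing
  simp only [map_sum, map_mul, weightCoaction_C, weightCoaction_X, pow_add]
  exact Finset.sum_congr rfl fun i _ => Finset.sum_congr rfl fun j _ => by ring

theorem natDegree_weightCoaction_pairing_le (N : ℕ) (α β : Fin 4) :
    (weightCoaction (leadWeight N) (pairing N α β)).natDegree ≤ 2 := by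
  rw [weightCoaction_pairing]
  refine Polynomial.natDegree_sum_le_of_forall_le _ _ fun i _ =>
    Polynomial.natDegree_sum_le_of_forall_le _ _ fun j _ =>
      (Polynomial.natDegree_C_mul_X_pow_le _ _).trans ?_
  exact add_le_add (leadWeight_le_one N _) (leadWeight_le_one N _)

/-- The excluded case i = j is harmless because `mMatrix` vanishes on the diagonal. -/
theorem coeff_weightCoaction_pairing (N : ℕ) (α β : Fin 4) (i₀ j₀ : Fin N)
    (hi₀ : leadWeight N (i₀, α) = 1) (hj₀ : leadWeight N (j₀, β) = 1)
    (h : ∀ i j : Fin N, (i : ℕ) / 2 = (j : ℕ) / 2 → i ≠ j → leadWeight N (i, α) = 1 →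
      leadWeight N (j, β) = 1 → i = i₀ ∧ j = j₀) :
    (weightCoaction (leadWeight N) (pairing N α β)).coeff 2 =
      C (mMatrix N i₀ j₀) * (X (i₀, α) * X (j₀, β)) := by
  rw [weightCoaction_pairing, Polynomial.finsetSum_coeff]
  have hz : ∀ i j : Fin N, ¬(i = i₀ ∧ j = j₀) →
      (Polynomial.C (C (mMatrix N i j) * X (i, α) * X (j, β) : SusyPoly N) *
        Polynomial.X ^ (leadWeight N (i, α) + leadWeight N (j, β))).coeff 2 = 0 := by
    intro i j hij
    rw [Polynomial.coeff_C_mul_X_pow]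
    split_ifs with h2
    · have h3 := leadWeight_le_one N (i, α)
      have h4 := leadWeight_le_one N (j, β)
      have hM : mMatrix N i j = 0 := by
        unfold mMatrix
        split_ifs with hb
        · by_cases hne : i = j
          · subst hne
            have : ∀ k : Fin 2, pauli 2 k k = 0 := by
              intro k; fin_cases k <;> simp [pauli]
            exact this _
          · exact absurd (h i j hb hne (by omega) (by omega)) hij
        · rfl
      simp [hM]
    · rfl
  rw [Finset.sum_eq_single i₀ _ (by simp), Polynomial.finsetSum_coeff,
    Finset.sum_eq_single j₀ _ (by simp)]
  · rw [Polynomial.coeff_C_mul_X_pow, hi₀, hj₀, if_pos rfl, mul_assoc]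
  · intro j _ hj
    exact hz i₀ j fun h => hj h.2
  · intro i _ hi
    rw [Polynomial.finsetSum_coeff]
    exact Finset.sum_eq_zero fun j _ => hz i j fun h => hi h.1

/-- Combinations of the quadrics of the standard representation, the first four of which have
coprime leading monomials. -/
noncomputable def adaptedQuadric (N : ℕ) : Fin 5 → SusyPoly N :=
  ![C Complex.I * pairing N 0 1, C Complex.I * pairing N 2 3, C (-Complex.I) * pairing N 0 2,
    C (-Complex.I) * pairing N 1 3, C Complex.I * (pairing N 0 3 + pairing N 1 2)]

/-- Two blocks of `mMatrix` suffice: the weight selects one monomial from each of P01 and P02 in the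
first block, and from each of P23 and P13 in the second. The eight variables involved are distinct.
-/
theorem koszulSyzygies_adaptedQuadric (N : ℕ) (hN : 4 ≤ N) (S : Finset (Fin 5)) (hS : 4 ∉ S) :
    KoszulSyzygies (adaptedQuadric N) S := by
  set n : Fin 4 → Fin N := Fin.castLE hN with hn
  set m : Fin 5 → (Fin N × Fin 4) →₀ ℕ :=
    ![Finsupp.single (n 0, 0) 1 + Finsupp.single (n 1, 1) 1,
      Finsupp.single (n 2, 2) 1 + Finsupp.single (n 3, 3) 1,
      Finsupp.single (n 1, 0) 1 + Finsupp.single (n 0, 2) 1,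
      Finsupp.single (n 3, 1) 1 + Finsupp.single (n 2, 3) 1, 0] with hm
  have hd : ∀ a b c d : Fin N × Fin 4, a ≠ c → a ≠ d → b ≠ c → b ≠ d →
      Disjoint (Finsupp.single a 1 + Finsupp.single b 1 : (Fin N × Fin 4) →₀ ℕ).support
        (Finsupp.single c 1 + Finsupp.single d 1 : (Fin N × Fin 4) →₀ ℕ).support := by
    intro a b c d h1 h2 h3 h4
    refine Finset.disjoint_of_subset_left Finsupp.support_add
      (Finset.disjoint_of_subset_right Finsupp.support_add ?_)
    simp only [Finset.disjoint_union_left, Finset.disjoint_union_right,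
      Finsupp.support_single _ one_ne_zero, Finset.disjoint_singleton]
    exact ⟨⟨h1, h3⟩, h2, h4⟩
  have hdisj : Pairwise fun i j => Disjoint (m i).support (m j).support := by
    intro i j hij
    fin_cases i <;> fin_cases j <;>
      first
      | exact absurd rfl hij
      | exact Finset.disjoint_empty_right _
      | exact Finset.disjoint_empty_left _
      | (refine hd _ _ _ _ ?_ ?_ ?_ ?_ <;> simp [n, Fin.ext_iff])
  have hlead : ∀ (z : ℂ) (α β : Fin 4) (i₀ j₀ : Fin N), z * mMatrix N i₀ j₀ = 1 →
      leadWeight N (i₀, α) = 1 → leadWeight N (j₀, β) = 1 →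
      (∀ i j : Fin N, (i : ℕ) / 2 = (j : ℕ) / 2 → i ≠ j → leadWeight N (i, α) = 1 →
        leadWeight N (j, β) = 1 → i = i₀ ∧ j = j₀) →
      monomial (Finsupp.single (i₀, α) 1 + Finsupp.single (j₀, β) 1) (1 : ℂ) =
        (weightCoaction (leadWeight N) (C z * pairing N α β)).coeff 2 := by
    intro z α β i₀ j₀ hz hi₀ hj₀ h
    rw [map_mul, weightCoaction_C, Polynomial.coeff_C_mul,
      coeff_weightCoaction_pairing N α β i₀ j₀ hi₀ hj₀ h, ← mul_assoc, ← C_mul, hz, C_1, one_mul,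
      X, X, monomial_mul, one_mul]
  have hdeg : ∀ z : ℂ, ∀ α β,
      (weightCoaction (leadWeight N) (C z * pairing N α β)).natDegree ≤ 2 := by
    intro z α β
    rw [map_mul, weightCoaction_C]
    exact (Polynomial.natDegree_C_mul_le _ _).trans (natDegree_weightCoaction_pairing_le N α β)
  refine KoszulSyzygies.of_leading (weightCoaction (leadWeight N)) (eval_one_weightCoaction _)
    (weightCoaction_coeff _) 2 ?_ ((koszulSyzygies_monomial m hdisj S).congr ?_)
  · intro i hi
    fin_cases i
    · exact hdeg _ _ _
    · exact hdeg _ _ _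
    · exact hdeg _ _ _
    · exact hdeg _ _ _
    · exact absurd hi hS
  · intro i hi
    fin_cases i
    · refine hlead _ 0 1 (n 0) (n 1) ?_ ?_ ?_ fun i j => ?_
      · simp [mMatrix, pauli, n]
      · simp [leadWeight, n]
      · simp [leadWeight, n]
      · simp [leadWeight, n, Fin.ext_iff]
        omega
    · refine hlead _ 2 3 (n 2) (n 3) ?_ ?_ ?_ fun i j => ?_
      · simp [mMatrix, pauli, n]
      · simp [leadWeight, n]
      · simp [leadWeight, n]
      · simp [leadWeight, n, Fin.ext_iff]
        omega
    · refine hlead _ 0 2 (n 1) (n 0) ?_ ?_ ?_ fun i j => ?_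
      · simp [mMatrix, pauli, n]
      · simp [leadWeight, n]
      · simp [leadWeight, n]
      · simp [leadWeight, n, Fin.ext_iff]
        omega
    · refine hlead _ 1 3 (n 3) (n 2) ?_ ?_ ?_ fun i j => ?_
      · simp [mMatrix, pauli, n]
      · simp [leadWeight, n]
      · simp [leadWeight, n]
      · simp [leadWeight, n, Fin.ext_iff]
        omega
    · exact absurd hi hS

end Regularity

end SusyAlg

namespace SusyAlg

open MvPolynomial CliffordAlgebra Module

/-! ### Linear change of the translation ghosts. -/

section BasisChange

/-- A basis of the translation ghosts adapted to `adaptedQuadric`, before rescaling. -/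
noncomputable def basisMatrix : Matrix (Fin 5) (Fin 5) ℂ :=
  !![1 / 2, Complex.I / 2, 0, 0, 0; 1 / 2, -Complex.I / 2, 0, 0, 0;
    0, 0, 1 / 2, Complex.I / 2, 0; 0, 0, -1 / 2, Complex.I / 2, 0; 0, 0, 0, 0, 1]

theorem basisMatrix_mul_inv : basisMatrix *
    !![1, 1, 0, 0, 0; -Complex.I, Complex.I, 0, 0, 0; 0, 0, 1, -1, 0;
      0, 0, -Complex.I, -Complex.I, 0; 0, 0, 0, 0, 1] = 1 := by
  ext i j
  fin_cases i <;> fin_cases j <;>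
    simp [basisMatrix, Matrix.mul_apply, Fin.sum_univ_five, ← mul_div_right_comm, neg_div] <;>
    norm_num

theorem scaledBasisMatrix_mul_inv (t : ℕ) :
    (basisMatrix * Matrix.diagonal fun a => (raisedFactor t a)⁻¹) *
      ((Matrix.diagonal fun a => raisedFactor t a) *
      !![1, 1, 0, 0, 0; -Complex.I, Complex.I, 0, 0, 0; 0, 0, 1, -1, 0;
      0, 0, -Complex.I, -Complex.I, 0; 0, 0, 0, 0, 1]) = 1 := by
  rw [Matrix.mul_assoc, ← Matrix.mul_assoc (Matrix.diagonal _), Matrix.diagonal_mul_diagonal]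
  simp only [inv_mul_cancel₀ (raisedFactor_ne_zero t _)]
  rw [Matrix.diagonal_one, Matrix.one_mul, basisMatrix_mul_inv]

theorem sum_basisMatrix_mul_stdQuadric (N : ℕ) (j : Fin 5) :
    ∑ a, C (basisMatrix j a) * stdQuadric N a = adaptedQuadric N j := by
  have h2 : (C 2⁻¹ * 2 : SusyPoly N) = 1 := by
    rw [← map_ofNat C 2, ← C_mul]; norm_num
  fin_cases j <;>
    simp [basisMatrix, stdQuadric, adaptedQuadric, Fin.sum_univ_five, div_eq_mul_inv]
  · linear_combination (C Complex.I * pairing N 0 1) * h2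
  · linear_combination (C Complex.I * pairing N 2 3) * h2
  · linear_combination -(C Complex.I * pairing N 0 2) * h2
  · linear_combination -(C Complex.I * pairing N 1 3) * h2

theorem exists_basis_of_mul_eq_one {R n : Type*} [CommRing R] [Fintype n] [DecidableEq n]
    {A B : Matrix n n R} (h : A * B = 1) : ∃ b : Basis n R (n → R), ∀ j a, b j a = A j a := by
  have h' : Aᵀ * Bᵀ = 1 := by rw [← Matrix.transpose_mul, mul_eq_one_comm.mp h]; simp
  refine ⟨(Pi.basisFun R n).map (Matrix.toLin'OfInv h' (mul_eq_one_comm.mp h')).symm, ?_⟩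
  intro j a
  simp [Matrix.toLin'OfInv]

end BasisChange

/-! ### Assembly: `gh` as a Koszul differential. -/

section Main

variable (N t : ℕ) (γ : Fin 5 → Matrix (Fin 4) (Fin 4) ℂ) (D : Matrix (Fin 4) (Fin 4) ℂ)

/-- The functional on the translation ghosts whose contraction is `gh`. -/
noncomputable def ghDual : Dual (SusyPoly N) (Fin 5 → SusyPoly N) :=
  ∑ a, ghC N t γ D a • LinearMap.proj a

theorem ghDual_apply (v : Fin 5 → SusyPoly N) :
    ghDual N t γ D v = ∑ a, ghC N t γ D a * v a := by
  simp [ghDual]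

theorem gh_apply (ω : GhostPoly N) : gh N t γ D ω = contractLeft (ghDual N t γ D) ω := by
  unfold gh ghDual dC
  rw [map_sum]
  simp only [map_smul]

theorem sum_ghC_mul_basisMatrix (R : Matrix (Fin 4) (Fin 4) ℂ) (hR : IsUnit R) (j : Fin 5) :
    ∑ a, ghC N t (fun a => R⁻¹ * stdGamma t a * R) (Rᵀ * stdC * R) a *
      C ((basisMatrix * Matrix.diagonal fun a => (raisedFactor t a)⁻¹) j a) =
      spinorSubst N (R⁻¹)ᵀ (adaptedQuadric N j) := by
  rw [← sum_basisMatrix_mul_stdQuadric, map_sum]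
  refine Finset.sum_congr rfl fun a _ => ?_
  rw [ghC_of_change N t R hR, ghC_std, Matrix.mul_diagonal, map_mul, map_mul, spinorSubst_C,
    map_mul, spinorSubst_C]
  have : (C (raisedFactor t a) * C (raisedFactor t a)⁻¹ : SusyPoly N) = 1 := by
    rw [← C_mul, mul_inv_cancel₀ (raisedFactor_ne_zero t a), C_1]
  linear_combination (C (basisMatrix j a) * spinorSubst N (R⁻¹)ᵀ (stdQuadric N a)) * this

/-- The change of the spinor basis by an invertible matrix, as an automorphism. -/
noncomputable def spinorSubstEquiv {A B : Matrix (Fin 4) (Fin 4) ℂ} (h : A * B = 1) :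
    SusyPoly N ≃ₐ[ℂ] SusyPoly N :=
  AlgEquiv.ofAlgHom (spinorSubst N A) (spinorSubst N B)
    (spinorSubst_comp_of_mul_eq_one N (mul_eq_one_comm.mp h))
    (spinorSubst_comp_of_mul_eq_one N h)

/-- There is a basis of the translation ghosts in which the coefficients of `gh` are the
adapted quadrics, up to an automorphism of the polynomials in the supersymmetry ghosts. -/
theorem exists_basis_ghDual (h : IsSpinorRep t γ D) :
    ∃ (b : Basis (Fin 5) (SusyPoly N) (Fin 5 → SusyPoly N)) (σ : SusyPoly N ≃ₐ[ℂ] SusyPoly N),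
      ∀ j, ghDual N t γ D (b j) = σ (adaptedQuadric N j) := by
  obtain ⟨R, hR, hγ, rfl⟩ := h
  obtain rfl : γ = fun a => R⁻¹ * stdGamma t a * R := funext hγ
  have hdet : IsUnit R.det := (Matrix.isUnit_iff_isUnit_det R).mp hR
  have h1 : (R⁻¹)ᵀ * Rᵀ = 1 := by
    rw [← Matrix.transpose_mul, Matrix.mul_nonsing_inv R hdet, Matrix.transpose_one]
  obtain ⟨b, hb⟩ := exists_basis_of_mul_eq_one (R := SusyPoly N)
    (A := (basisMatrix * Matrix.diagonal fun a => (raisedFactor t a)⁻¹).map C)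
    (by rw [← Matrix.map_mul, scaledBasisMatrix_mul_inv, Matrix.map_one _ C_0 C_1])
  refine ⟨b, spinorSubstEquiv N h1, fun j => ?_⟩
  rw [ghDual_apply]
  simp only [hb, Matrix.map_apply]
  exact sum_ghC_mul_basisMatrix N t R hR j

variable {N t γ D}

theorem koszulExact_ghDual (hN : 4 ≤ N)
    {b : Basis (Fin 5) (SusyPoly N) (Fin 5 → SusyPoly N)} {σ : SusyPoly N ≃ₐ[ℂ] SusyPoly N}
    (hb : ∀ j, ghDual N t γ D (b j) = σ (adaptedQuadric N j)) (T : Finset (Fin 5)) (hT : 4 ∉ T) :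
    KoszulExact b (ghDual N t γ D) T := by
  induction T using Finset.induction_on with
  | empty => exact koszulExact_empty b _
  | insert c T hc ih =>
    refine (ih fun h => hT (Finset.mem_insert_of_mem h)).insert hc fun r g hr => ?_
    obtain ⟨g', hg'⟩ := (koszulSyzygies_adaptedQuadric N hN _ hT).regular hc (σ.symm r)
      (fun a => σ.symm (g a)) (by
        have := congrArg σ.symm hr
        simpa [hb] using this)
    refine ⟨fun a => σ (g' a), ?_⟩
    have := congrArg σ hg'
    simpa [hb] using this

/-- The components of an element of degree at least two have no scalar part. -/
theorem algebraMapInv_contractLeft_eq_zero {p : ℕ} (hp : 1 < p) {ω : GhostPoly N}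
    (hω : cNumber N ω = p • ω) (φ : Dual (SusyPoly N) (Fin 5 → SusyPoly N)) :
    ExteriorAlgebra.algebraMapInv (contractLeft φ ω) = 0 := by
  have h1 := congrArg (fun x : GhostPoly N => ExteriorAlgebra.algebraMapInv (contractLeft φ x)) hω
  have h2 := contractLeft_eq_sum (Pi.basisFun (SusyPoly N) (Fin 5)) φ ω
  have h3 : ∀ a, (Pi.basisFun (SusyPoly N) (Fin 5)).coord a = LinearMap.proj a := by
    intro a; ext; simp
  simp only [h3, Pi.basisFun_apply] at h2
  -- The scalar part of a contraction sees only the linear part of ω, on which the counting operator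
  -- is the identity. Comparing with the eigenvalue p leaves the factor p - 1, nonzero since p > 1.
  have h4 : ExteriorAlgebra.algebraMapInv (contractLeft φ (cNumber N ω)) =
      ExteriorAlgebra.algebraMapInv (contractLeft φ ω) := by
    unfold cNumber cGhost dC
    rw [map_sum, h2, map_sum, map_sum]
    refine Finset.sum_congr rfl fun a _ => ?_
    rw [contractLeft_exteriorι_mul, map_sub, algebraMapInv_ι_mul, sub_zero]
  simp only [h4, map_nsmul] at h1
  have h5 : ((p - 1 : ℕ) : SusyPoly N) *
      ExteriorAlgebra.algebraMapInv (contractLeft φ ω) = 0 := by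
    rw [nsmul_eq_mul] at h1
    rw [Nat.cast_sub hp.le, sub_mul, ← h1]
    simp
  refine (mul_eq_zero.mp h5).resolve_left ?_
  exact Nat.cast_ne_zero.mpr (by omega)

theorem algebraMapInv_eq_zero {p : ℕ} (hp : 1 < p) {ω : GhostPoly N}
    (hω : cNumber N ω = p • ω) : ExteriorAlgebra.algebraMapInv ω = 0 := by
  have h1 := congrArg (ExteriorAlgebra.algebraMapInv (R := SusyPoly N)) hω
  unfold cNumber cGhost at h1
  rw [map_sum, Finset.sum_eq_zero fun a _ => algebraMapInv_ι_mul _ _, map_nsmul, nsmul_eq_mul] at h1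
  exact (mul_eq_zero.mp h1.symm).resolve_left (Nat.cast_ne_zero.mpr (by omega))

end Main

end SusyAlg

theorem mainTheorem5 (N : ℕ) (hN : Even N) (hN2 : 2 < N) (t : ℕ) (ht : t ≤ 5)
    (γ : Fin 5 → Matrix (Fin 4) (Fin 4) ℂ) (C : Matrix (Fin 4) (Fin 4) ℂ)
    (hγ : SusyAlg.IsSpinorRep t γ C)
    (p : ℕ) (hp : 1 < p) (ω : SusyAlg.GhostPoly N) (hω : SusyAlg.cNumber N ω = p • ω) :
    SusyAlg.gh N t γ C ω = 0 ↔ SusyAlg.GhEquiv N t γ C ω 0 := by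
  simp only [SusyAlg.GhEquiv, SusyAlg.gh_apply, sub_zero]
  constructor
  · intro h
    have hN4 : 4 ≤ N := by
      obtain ⟨k, rfl⟩ := hN
      omega
    obtain ⟨b, σ, hb⟩ := SusyAlg.exists_basis_ghDual N t γ C hγ
    have hT := SusyAlg.koszulExact_ghDual hN4 hb {4}ᶜ (by simp)
    -- This is where p > 1 enters: it removes the scalar part of the contraction, so exactness over
    -- the four regular quadrics applies without regularity of the fifth.
    obtain ⟨z, hz, hz'⟩ := hT (CliffordAlgebra.contractLeft (b.coord 4) ω)
      (fun a ha => by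
        obtain rfl : a = 4 := by simpa using ha
        exact CliffordAlgebra.contractLeft_contractLeft _ _)
      (by rw [CliffordAlgebra.contractLeft_comm, h, map_zero, neg_zero])
      (SusyAlg.algebraMapInv_contractLeft_eq_zero hp hω _)
    obtain ⟨y, -, hy⟩ := hT.exists_of_contractLeft (c := 4) (by simp) ω
      (fun a ha => absurd ha (by simp)) h (SusyAlg.algebraMapInv_eq_zero hp hω) z hz hz'
    exact ⟨y, hy⟩
  · rintro ⟨y, rfl⟩
    exact CliffordAlgebra.contractLeft_contractLeft _ _
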